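/- For integers $n\geq k\geq 1$, an $(n,k)$-Sperner partition system is a collection of partitions of some $n$-element set, each into exactly $k$ nonempty classes, such that no class of any partition in the collection is a subset of a class of any other partition in the collection. Let $\mathrm{SP}(n,k)$ denote the maximum number of partitions in an $(n,k)$-Sperner partition system. Let $k\geq 11$ be an integer such that $k\not\equiv 4 \pmod 6$, and let $n=3k-6$. Then $$\mathrm{SP}(n,k)=\left\lfloor \tfrac12 (k-2)^2\right\rfloor .$$ -/

import Mathlib

/-- A family `P` of partitions of the finite set `X` is a *Sperner partition system with `k`
classes*: each partition in `P` has exactly `k` (automatically nonempty) classes, and no class of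
a partition in `P` is a subset of a class of a different partition in `P`. -/
def IsSpernerPartitionSystem {α : Type*} [DecidableEq α] {X : Finset α} (k : ℕ)
    (P : Finset (Finpartition X)) : Prop :=
  (∀ π ∈ P, π.parts.card = k) ∧
    ∀ π ∈ P, ∀ σ ∈ P, π ≠ σ → ∀ A ∈ π.parts, ∀ B ∈ σ.parts, ¬ A ⊆ B

/-- The set of all numbers `p` such that some `(n, k)`-Sperner partition system consists of
exactly `p` partitions. -/
def spernerSystemSizes (n k : ℕ) : Set ℕ :=
  {p | ∃ P : Finset (Finpartition (Finset.univ : Finset (Fin n))),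
    IsSpernerPartitionSystem k P ∧ P.card = p}

/-- `SP n k` is the maximum number of partitions in an `(n, k)`-Sperner partition system. -/
noncomputable def SP (n k : ℕ) : ℕ := sSup (spernerSystemSizes n k)

/-- The maximum defining `SP n k` is always attained. -/
theorem SP_isGreatest (n k : ℕ) : IsGreatest (spernerSystemSizes n k) (SP n k) := by
  have hne : (spernerSystemSizes n k).Nonempty :=
    ⟨0, ∅, by simp [IsSpernerPartitionSystem], Finset.card_empty⟩
  have hbdd : BddAbove (spernerSystemSizes n k) := by
    refine ⟨Fintype.card (Finpartition (Finset.univ : Finset (Fin n))), ?_⟩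
    rintro p ⟨P, -, rfl⟩
    exact Finset.card_le_univ P
  exact ⟨Nat.sSup_mem hne hbdd, fun p hp => le_csSup hbdd hp⟩

/-! Put m = k - 2, so that n = 3m and the bound reads ⌊m²/2⌋.

Upper bound: give each point of a class A the weight 3/|A| - 1. A partition weighs 3(m+2) - 3m = 6
in all. If there were p > m²/2 partitions, the classes through any one point would weigh at most m
together (`sum_three_div_card_sub_one_le`), whence 6p ≤ 3m·m, a contradiction. The local bound holds
because only pairs count positively, and many pairs at a point leave little room for other classes
there.

Lower bound: cut the points into three fibres of size m and use only triples inside a fibre and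
pairs across two fibres; none of these sets contains another. A Baranyai-type theorem
(`exists_disjoint_partitions`) reduces the construction to choosing how many sets of each profile
each partition takes. Six pairs and m - 4 triples per partition are needed, and the 3m² pairs
suffice for ⌊m²/2⌋ partitions. The theorem rests on balancing two points of a fibre in all colours
at once (`exists_recolouring_pair`), which amounts to a balanced orientation of a multigraph on the
colours. -/

/-! ### Almost regular colourings of hypergraphs -/

/-- The degree of `v` in the colour class `c` of the hypergraph `ℰ` coloured by `γ`. -/
def colourDegree {V C : Type*} [DecidableEq V] [DecidableEq C] (ℰ : Finset (Finset V))
    (γ : Finset V → C) (c : C) (v : V) : ℤ :=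
  ∑ E ∈ ℰ with γ E = c, if v ∈ E then 1 else 0

/-- Signed sums of edge vectors `e_u - e_w` can be balanced: the edges of every finite multigraph
can be oriented so that the in-degree and the out-degree differ by at most one at each vertex. -/
theorem exists_balanced_signing {Ω C : Type*} [DecidableEq Ω] [DecidableEq C] (s : Finset Ω)
    (d : Ω → C → ℤ) (hd : ∀ E, ∃ u w, d E = Pi.single u 1 - Pi.single w 1) :
    ∃ ε : Ω → ℤ, (∀ E, ε E = 1 ∨ ε E = -1) ∧ ∀ c, |∑ E ∈ s, ε E * d E c| ≤ 1 := by
  induction s using Finset.strongInduction generalizing d with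
  | H s ih =>
  by_cases hs : ∃ E₁ ∈ s, ∃ E₂ ∈ s, E₁ ≠ E₂ ∧ ∃ v, d E₁ v ≠ 0 ∧ d E₂ v ≠ 0
  · obtain ⟨E₁, h₁, E₂, h₂, hne, v, hv₁, hv₂⟩ := hs
    have key : ∀ E, d E v ≠ 0 → ∃ η : ℤ, (η = 1 ∨ η = -1) ∧ ∃ u,
        ∀ c, η * d E c = (Pi.single u 1 - Pi.single v 1 : C → ℤ) c := by
      intro E hE
      obtain ⟨u, w, huw⟩ := hd E
      rcases eq_or_ne v w with rfl | hw
      · exact ⟨1, Or.inl rfl, u, fun c => by rw [huw, one_mul]⟩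
      · rcases eq_or_ne v u with rfl | hu
        · exact ⟨-1, Or.inr rfl, w, fun c => by rw [huw]; simp⟩
        · simp [huw, hw, hu] at hE
    obtain ⟨η₁, hη₁, u₁, hu₁⟩ := key E₁ hv₁
    obtain ⟨η₂, hη₂, u₂, hu₂⟩ := key E₂ hv₂
    -- The path u₁, v, u₂ formed by two edges at v is replaced by one edge from u₂ to u₁; orienting
    -- the path consistently makes its contributions at v cancel.
    obtain ⟨ε, hε, hb⟩ := ih (s.erase E₂) (Finset.erase_ssubset h₂)
      (Function.update d E₁ (Pi.single u₁ 1 - Pi.single u₂ 1)) (by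
        intro E
        rcases eq_or_ne E E₁ with rfl | h
        · exact ⟨u₁, u₂, by simp⟩
        · simpa [h] using hd E)
    have hsign : ∀ x y : ℤ, (x = 1 ∨ x = -1) → (y = 1 ∨ y = -1) → (x * y = 1 ∨ x * y = -1) := by
      rintro x y (rfl | rfl) (rfl | rfl) <;> simp
    refine ⟨fun E => if E = E₁ then ε E₁ * η₁ else if E = E₂ then -(ε E₁ * η₂) else ε E, ?_, ?_⟩
    · intro E
      dsimp only
      split_ifs
      · exact hsign _ _ (hε _) hη₁
      · rcases hsign _ _ (hε E₁) hη₂ with h | h <;> simp [h]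
      · exact hε E
    · intro c
      refine le_of_eq_of_le (congrArg _ ?_) (hb c)
      have h₁' : E₁ ∈ s.erase E₂ := Finset.mem_erase.2 ⟨hne, h₁⟩
      rw [← Finset.add_sum_erase s _ h₂, ← Finset.add_sum_erase _ _ h₁',
        ← Finset.add_sum_erase (s.erase E₂) _ h₁', ← add_assoc]
      congr 1
      · simp only [hne.symm, if_true, if_false, Function.update_self]
        have e₁ := hu₁ c
        have e₂ := hu₂ c
        simp only [Pi.sub_apply] at e₁ e₂ ⊢
        linear_combination ε E₁ * e₁ - ε E₁ * e₂
      · refine Finset.sum_congr rfl fun E hE => ?_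
        simp only [Finset.mem_erase] at hE
        simp [hE.1, hE.2.1]
  -- No two edges meet, so each coordinate has at most one nonzero term and any signs work.
  · push Not at hs
    refine ⟨fun _ => 1, fun _ => Or.inl rfl, fun c => ?_⟩
    have hle : ∀ E, |d E c| ≤ 1 := by
      intro E
      obtain ⟨u, w, huw⟩ := hd E
      rw [huw]
      simp only [Pi.sub_apply, Pi.single_apply]
      split_ifs <;> simp
    simp only [one_mul]
    by_cases h : ∃ E ∈ s, d E c ≠ 0
    · obtain ⟨E, hE, hc⟩ := h
      rw [Finset.sum_eq_single_of_mem E hE fun E' hE' hne => hs E hE E' hE' hne.symm c hc]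
      exact hle E
    · push Not at h
      simp [Finset.sum_eq_zero h]

section Recolouring

variable {V ι C : Type*} [DecidableEq V] [DecidableEq ι] [DecidableEq C]

/-- The number of points that `E` has in each fibre of `g`. -/
def fibreProfile (g : V → ι) (E : Finset V) (i : ι) : ℕ := (E.filter (g · = i)).card

theorem fibreProfile_swap (g : V → ι) {α β : V} (h : g α = g β) (E : Finset V) :
    fibreProfile g (E.map (Equiv.swap α β).toEmbedding) = fibreProfile g E := by
  have hg : ∀ v, g (Equiv.swap α β v) = g v := by
    intro v
    rcases eq_or_ne v α with rfl | ha
    · simp [h]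
    rcases eq_or_ne v β with rfl | hb
    · simp [h]
    rw [Equiv.swap_apply_of_ne_of_ne ha hb]
  ext i
  simp [fibreProfile, Finset.filter_map, hg]

/-- Exchanging the colours of `E` and of its image under the transposition of `α` and `β`, for
suitable edges `E`, balances the degrees of `α` and `β` in all colour classes at once. -/
theorem exists_recolouring_pair [Fintype ι] (g : V → ι) (ℰ : Finset (Finset V))
    (hℰ : ∀ E E', fibreProfile g E = fibreProfile g E' → E ∈ ℰ → E' ∈ ℰ) (γ : Finset V → C)
    {α β : V} (hg : g α = g β) :
    ∃ γ' : Finset V → C,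
      (∀ c T, (ℰ.filter fun E => γ' E = c ∧ fibreProfile g E = T).card =
        (ℰ.filter fun E => γ E = c ∧ fibreProfile g E = T).card) ∧
      (∀ c v, v ≠ α → v ≠ β → colourDegree ℰ γ' c v = colourDegree ℰ γ c v) ∧
      (∀ c, colourDegree ℰ γ' c α + colourDegree ℰ γ' c β =
        colourDegree ℰ γ c α + colourDegree ℰ γ c β) ∧
      ∀ c, |colourDegree ℰ γ' c α - colourDegree ℰ γ' c β| ≤ 1 := by
  set σ : Finset V → Finset V := fun E => E.map (Equiv.swap α β).toEmbedding with hσ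
  have hσσ : ∀ E, σ (σ E) = E := by
    intro E
    ext v
    simp [hσ, Finset.mem_map_equiv]
  have hmem : ∀ v E, v ∈ σ E ↔ Equiv.swap α β v ∈ E := by
    intro v E
    simp [hσ, Finset.mem_map_equiv]
  have hασ : ∀ E, α ∈ σ E ↔ β ∈ E := fun E => by simp [hmem]
  have hβσ : ∀ E, β ∈ σ E ↔ α ∈ E := fun E => by simp [hmem]
  have hvσ : ∀ v E, v ≠ α → v ≠ β → (v ∈ σ E ↔ v ∈ E) := fun v E h h' => by
    rw [hmem, Equiv.swap_apply_of_ne_of_ne h h']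
  have hpσ : ∀ E, fibreProfile g (σ E) = fibreProfile g E := fibreProfile_swap g hg
  have hℰσ : ∀ E, E ∈ ℰ → σ E ∈ ℰ := fun E => hℰ _ _ (hpσ E).symm
  set Ω := ℰ.filter fun E => α ∈ E ∧ β ∉ E with hΩ
  -- The colours are the vertices, and E joins its colour to that of `σ E`. A sign -1 means
  -- exchanging the two colours, so coordinate c of the signed sum is the new degree difference of α
  -- and β in colour c.
  obtain ⟨ε, hε, hb⟩ := exists_balanced_signing Ω
    (fun E => (Pi.single (γ E) 1 - Pi.single (γ (σ E)) 1 : C → ℤ)) fun E => ⟨_, _, rfl⟩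
  -- the edges whose colour is exchanged with that of their image
  set flip : Finset V → Prop := fun E =>
    (α ∈ E ∧ β ∉ E ∧ ε E = -1) ∨ (β ∈ E ∧ α ∉ E ∧ ε (σ E) = -1) with hflip
  have hfσ : ∀ E, flip (σ E) ↔ flip E := by
    intro E
    simp only [hflip, hασ, hβσ, hσσ]
    tauto
  classical
  set θ : Finset V → Finset V := fun E => if flip E then σ E else E with hθ
  have hθθ : ∀ E, θ (θ E) = E := by
    intro E
    by_cases h : flip E
    · simp [hθ, h, hfσ, hσσ]
    · simp [hθ, h]
  have hθℰ : ∀ E, E ∈ ℰ → θ E ∈ ℰ := by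
    intro E hE
    by_cases h : flip E
    · simpa [hθ, h] using hℰσ E hE
    · simpa [hθ, h] using hE
  have hsum : ∀ (c : C) (w : Finset V → ℤ), (∀ E, w (σ E) = w E) →
      ∑ E ∈ ℰ with γ (θ E) = c, w E = ∑ E ∈ ℰ with γ E = c, w E := by
    intro c w hw
    refine Finset.sum_bij' (fun E _ => θ E) (fun E _ => θ E) ?_ ?_ ?_ ?_ ?_
    · intro E hE
      simp only [Finset.mem_filter] at hE ⊢
      exact ⟨hθℰ E hE.1, hE.2⟩
    · intro E hE
      simp only [Finset.mem_filter] at hE ⊢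
      exact ⟨hθℰ E hE.1, by rw [hθθ]; exact hE.2⟩
    · intro E _; exact hθθ E
    · intro E _; exact hθθ E
    · intro E _
      by_cases h : flip E
      · simp [hθ, h, hw]
      · simp [hθ, h]
  refine ⟨fun E => γ (θ E), ?_, ?_, ?_, ?_⟩
  · intro c T
    have := hsum c (fun E => if fibreProfile g E = T then 1 else 0) (fun E => by rw [hpσ])
    rw [Finset.sum_boole, Finset.sum_boole, Finset.filter_filter, Finset.filter_filter] at this
    exact_mod_cast this
  · intro c v ha hb'
    exact hsum c (fun E => if v ∈ E then 1 else 0) fun E => by simp [hvσ v E ha hb']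
  · intro c
    simp only [colourDegree, ← Finset.sum_add_distrib]
    exact hsum c (fun E => (if α ∈ E then 1 else 0) + if β ∈ E then 1 else 0) fun E => by
      simp only [hασ, hβσ]; ring
  · intro c
    refine le_of_eq_of_le (congrArg _ ?_) (hb c)
    set f : Finset V → ℤ := fun E => if γ (θ E) = c then 1 else 0 with hf
    have e₁ : colourDegree ℰ (fun E => γ (θ E)) c α - colourDegree ℰ (fun E => γ (θ E)) c β =
        ∑ E ∈ ℰ, ((if α ∈ E ∧ β ∉ E then f E else 0) - if β ∈ E ∧ α ∉ E then f E else 0) := by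
      simp only [colourDegree, ← Finset.sum_sub_distrib, Finset.sum_filter]
      refine Finset.sum_congr rfl fun E _ => ?_
      by_cases h1 : α ∈ E <;> by_cases h2 : β ∈ E <;> simp [h1, h2, hf]
    have e₂ : ∑ E ∈ ℰ, (if β ∈ E ∧ α ∉ E then f E else 0) =
        ∑ E ∈ ℰ, (if α ∈ E ∧ β ∉ E then f (σ E) else 0) := by
      refine Finset.sum_bij' (fun E _ => σ E) (fun E _ => σ E) (fun E h => hℰσ E h)
        (fun E h => hℰσ E h) (fun E _ => hσσ E) (fun E _ => hσσ E) fun E _ => ?_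
      simp only [hασ, hβσ, hσσ]
    rw [e₁, Finset.sum_sub_distrib, e₂, ← Finset.sum_sub_distrib, hΩ, Finset.sum_filter]
    refine Finset.sum_congr rfl fun E _ => ?_
    by_cases h : α ∈ E ∧ β ∉ E
    · simp only [h, not_false_eq_true, and_self, if_true, hf]
      have hfE : flip E ↔ ε E = -1 := by simp [hflip, h.1, h.2]
      have hfE' : flip (σ E) ↔ ε E = -1 := (hfσ E).trans hfE
      simp only [hθ, hfE, hfE', hσσ, Pi.sub_apply, Pi.single_apply]
      rcases hε E with h' | h' <;> simp [h', eq_comm]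
    · simp [h]

/-- Every colouring of a hypergraph that is closed under permutations within the fibres of `g` can
be rearranged, keeping the number of edges of each profile in each colour, so that
each colour class is almost regular on every fibre. -/
theorem exists_equitable_recolouring [Fintype V] [Fintype ι] [Fintype C] (g : V → ι) (ℰ : Finset (Finset V))
    (hℰ : ∀ E E', fibreProfile g E = fibreProfile g E' → E ∈ ℰ → E' ∈ ℰ) (γ₀ : Finset V → C) :
    ∃ γ : Finset V → C,
      (∀ c T, (ℰ.filter fun E => γ E = c ∧ fibreProfile g E = T).card =
        (ℰ.filter fun E => γ₀ E = c ∧ fibreProfile g E = T).card) ∧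
      ∀ c α β, g α = g β → colourDegree ℰ γ c α ≤ colourDegree ℰ γ c β + 1 := by
  classical
  have hfin : {γ : Finset V → C | ∀ c T,
      (ℰ.filter fun E => γ E = c ∧ fibreProfile g E = T).card =
        (ℰ.filter fun E => γ₀ E = c ∧ fibreProfile g E = T).card}.Finite := Set.toFinite _
  -- Balancing α and β preserves the sum of their degrees in each colour, so it never raises the sum
  -- of squares, and lowers it strictly if some difference was at least 2.
  obtain ⟨γ, hγ, hmin⟩ := Set.exists_min_image _
    (fun γ => ∑ c, ∑ v, colourDegree ℰ γ c v ^ 2) hfin ⟨γ₀, fun _ _ => rfl⟩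
  refine ⟨γ, hγ, fun c₀ α β hg => ?_⟩
  by_contra! hlt
  have hαβ : α ≠ β := by rintro rfl; linarith
  obtain ⟨γ', h₁, h₂, h₃, h₄⟩ := exists_recolouring_pair g ℰ hℰ γ hg
  refine absurd (hmin γ' fun c T => (h₁ c T).trans (hγ c T)) (not_le.2 ?_)
  have hsplit : ∀ (γ : Finset V → C) c, ∑ v, colourDegree ℰ γ c v ^ 2 =
      colourDegree ℰ γ c α ^ 2 + colourDegree ℰ γ c β ^ 2 +
        ∑ v ∈ (Finset.univ.erase α).erase β, colourDegree ℰ γ c v ^ 2 := by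
    intro γ c
    rw [← Finset.add_sum_erase Finset.univ _ (Finset.mem_univ α),
      ← Finset.add_sum_erase (Finset.univ.erase α) _
        (Finset.mem_erase.2 ⟨hαβ.symm, Finset.mem_univ β⟩), add_assoc]
  have hrest : ∀ c, ∑ v ∈ (Finset.univ.erase α).erase β, colourDegree ℰ γ' c v ^ 2 =
      ∑ v ∈ (Finset.univ.erase α).erase β, colourDegree ℰ γ c v ^ 2 := by
    intro c
    refine Finset.sum_congr rfl fun v hv => ?_
    simp only [Finset.mem_erase] at hv
    rw [h₂ c v hv.2.1 hv.1]
  have hid : ∀ x y : ℤ, 2 * (x ^ 2 + y ^ 2) = (x + y) ^ 2 + (x - y) ^ 2 := fun x y => by ring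
  refine Finset.sum_lt_sum (fun c _ => ?_) ⟨c₀, Finset.mem_univ _, ?_⟩
  · rw [hsplit, hsplit, hrest]
    have a := hid (colourDegree ℰ γ' c α) (colourDegree ℰ γ' c β)
    have b := hid (colourDegree ℰ γ c α) (colourDegree ℰ γ c β)
    rw [h₃ c] at a
    have : (colourDegree ℰ γ' c α - colourDegree ℰ γ' c β) ^ 2 ≤
        (colourDegree ℰ γ c α - colourDegree ℰ γ c β) ^ 2 := by
      have h3 := h₃ c
      have h4 := abs_le.1 (h₄ c)
      rw [sq_le_sq, le_abs', abs_le']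
      rw [abs_eq_max_neg]
      omega
    linarith
  · rw [hsplit, hsplit, hrest]
    have a := hid (colourDegree ℰ γ' c₀ α) (colourDegree ℰ γ' c₀ β)
    have b := hid (colourDegree ℰ γ c₀ α) (colourDegree ℰ γ c₀ β)
    rw [h₃ c₀] at a
    have h4 := abs_le.1 (h₄ c₀)
    have : (colourDegree ℰ γ' c₀ α - colourDegree ℰ γ' c₀ β) ^ 2 <
        (colourDegree ℰ γ c₀ α - colourDegree ℰ γ c₀ β) ^ 2 := by nlinarith
    linarith

end Recolouring

/-! ### The upper bound -/

/-- The sets of an antichain through a common point `x`, among `3 * m` points, with more than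
`m ^ 2 / 2` members. -/
theorem sum_three_div_card_sub_one_le {V I : Type*} [Fintype V] [DecidableEq V] [DecidableEq I]
    {m : ℕ} (hm : 9 ≤ m) (hV : Fintype.card V = 3 * m) (P : Finset I) (hP : m ^ 2 + 1 ≤ 2 * P.card)
    (A : I → Finset V) (x : V) (hx : ∀ π ∈ P, x ∈ A π)
    (hA : ∀ π ∈ P, ∀ σ ∈ P, π ≠ σ → ¬ A π ⊆ A σ) :
    ∑ π ∈ P, (3 / (A π).card - 1 : ℚ) ≤ m := by
  have hinj : ∀ π ∈ P, ∀ σ ∈ P, A π = A σ → π = σ := by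
    intro π hπ σ hσ h
    by_contra hne
    exact hA π hπ σ hσ hne h.subset
  have hone : 1 < P.card := by nlinarith
  have hsize : ∀ π ∈ P, 2 ≤ (A π).card := by
    intro π hπ
    by_contra! h
    obtain ⟨σ, hσ, hne⟩ := Finset.exists_mem_ne hone π
    refine hA π hπ σ hσ hne.symm fun y hy => ?_
    rw [Finset.card_le_one.1 (by omega : (A π).card ≤ 1) y hy x (hx π hπ)]
    exact hx σ hσ
  set P₂ := P.filter fun π => (A π).card = 2 with hP₂
  set P₃ := P.filter fun π => (A π).card = 3 with hP₃
  set P₄ := P.filter fun π => 4 ≤ (A π).card with hP₄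
  have hcard : P.card = P₂.card + P₃.card + P₄.card := by
    simp only [hP₂, hP₃, hP₄, Finset.card_filter, ← Finset.sum_add_distrib]
    rw [Finset.card_eq_sum_ones]
    refine Finset.sum_congr rfl fun π hπ => ?_
    have := hsize π hπ
    split_ifs <;> omega
  -- Pairs weigh 1/2, triples 0, and larger sets at most -1/4.
  have hsum : ∑ π ∈ P, (3 / (A π).card - 1 : ℚ) ≤ P₂.card / 2 - P₄.card / 4 := by
    have h₂ : (P₂.card : ℚ) / 2 = ∑ π ∈ P, if (A π).card = 2 then (1 / 2 : ℚ) else 0 := by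
      rw [← Finset.sum_filter, Finset.sum_const, nsmul_eq_mul]; ring
    have h₄ : (P₄.card : ℚ) / 4 = ∑ π ∈ P, if 4 ≤ (A π).card then (1 / 4 : ℚ) else 0 := by
      rw [← Finset.sum_filter, Finset.sum_const, nsmul_eq_mul]; ring
    rw [h₂, h₄, ← Finset.sum_sub_distrib]
    refine Finset.sum_le_sum fun π hπ => ?_
    have h := hsize π hπ
    rcases (by omega : (A π).card = 2 ∨ (A π).card = 3 ∨ 4 ≤ (A π).card) with h | h | h
    · norm_num [h]
    · norm_num [h]
    · have h' : (4 : ℚ) ≤ (A π).card := by exact_mod_cast h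
      have : (3 : ℚ) / (A π).card ≤ 3 / 4 := by gcongr
      have hne : (A π).card ≠ 2 := by omega
      simp only [h, hne, if_true, if_false]
      linarith
  -- `Z` holds the partners of x in the pairs. The larger sets contain no such pair, so apart from x
  -- they live in `Y`.
  set Z := P₂.biUnion fun π => (A π).erase x with hZ
  set Y := (Finset.univ.erase x) \ Z with hY
  have hZcard : Z.card = P₂.card := by
    have hone' : ∀ π ∈ P₂, ((A π).erase x).card = 1 := by
      intro π hπ
      simp only [hP₂, Finset.mem_filter] at hπ
      rw [Finset.card_erase_of_mem (hx π hπ.1), hπ.2]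
    rw [hZ, Finset.card_biUnion, Finset.sum_congr rfl hone', Finset.card_eq_sum_ones]
    intro π hπ σ hσ hne
    obtain ⟨a, ha⟩ := Finset.card_eq_one.1 (hone' π hπ)
    obtain ⟨b, hb⟩ := Finset.card_eq_one.1 (hone' σ hσ)
    have hπ := (Finset.mem_filter.1 hπ).1
    have hσ := (Finset.mem_filter.1 hσ).1
    rw [Function.onFun, ha, hb, Finset.disjoint_singleton]
    rintro rfl
    refine hne (hinj π hπ σ hσ ?_)
    rw [← Finset.insert_erase (hx π hπ), ← Finset.insert_erase (hx σ hσ), ha, hb]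
  have hYcard : Y.card + P₂.card + 1 = 3 * m := by
    have hsub : Z ⊆ Finset.univ.erase x := by
      intro y hy
      simp only [hZ, Finset.mem_biUnion, Finset.mem_erase] at hy
      obtain ⟨π, -, h, -⟩ := hy
      simp [h]
    have h := Finset.card_sdiff_add_card_eq_card hsub
    rw [Finset.card_erase_of_mem (Finset.mem_univ x), Finset.card_univ, hV, hZcard, ← hY] at h
    omega
  have hsubY : ∀ π ∈ P, (A π).card ≠ 2 → (A π).erase x ⊆ Y := by
    intro π hπ h2 y hy
    simp only [Finset.mem_erase] at hy
    simp only [hY, hZ, hP₂, Finset.mem_sdiff, Finset.mem_erase, Finset.mem_univ, and_true,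
      Finset.mem_biUnion, Finset.mem_filter, not_exists, not_and]
    refine ⟨hy.1, fun σ hσ _ hyσ => ?_⟩
    refine hA σ hσ.1 π hπ (by rintro rfl; exact h2 hσ.2) ?_
    have : {x, y} = A σ := Finset.eq_of_subset_of_card_le
      (by simp [Finset.insert_subset_iff, hx σ hσ.1, hyσ])
      (by rw [hσ.2, Finset.card_pair (Ne.symm hy.1)])
    rw [← this]
    simp [Finset.insert_subset_iff, hx π hπ, hy.2]
  set Q := P₃.image fun π => (A π).erase x with hQ
  have hQcard : Q.card = P₃.card := by
    refine Finset.card_image_of_injOn fun π hπ σ hσ h => ?_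
    have hπ := (Finset.mem_filter.1 hπ).1
    have hσ := (Finset.mem_filter.1 hσ).1
    refine hinj π hπ σ hσ ?_
    rw [← Finset.insert_erase (hx π hπ), ← Finset.insert_erase (hx σ hσ), h]
  have hQsub : Q ⊆ Y.powersetCard 2 := by
    intro B hB
    simp only [hQ, hP₃, Finset.mem_image, Finset.mem_filter] at hB
    obtain ⟨π, ⟨hπ, h3⟩, rfl⟩ := hB
    rw [Finset.mem_powersetCard, Finset.card_erase_of_mem (hx π hπ), h3]
    exact ⟨hsubY π hπ (by omega), rfl⟩
  have hP₃le : P₃.card ≤ Y.card.choose 2 := by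
    rw [← hQcard, ← Finset.card_powersetCard]
    exact Finset.card_le_card hQsub
  -- A larger set has three points besides x, and none of their three pairs may form a triple of the
  -- family with x.
  have hP₃le' : P₄.card ≠ 0 → P₃.card + 3 ≤ Y.card.choose 2 := by
    intro h
    obtain ⟨π, hπ⟩ := Finset.card_ne_zero.1 h
    simp only [hP₄, Finset.mem_filter] at hπ
    obtain ⟨B, hB, hB3⟩ := Finset.exists_subset_card_eq
      (show 3 ≤ ((A π).erase x).card by rw [Finset.card_erase_of_mem (hx π hπ.1)]; omega)
    have hdisj : Disjoint Q (B.powersetCard 2) := by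
      rw [Finset.disjoint_left]
      intro D hD hDB
      simp only [hQ, hP₃, Finset.mem_image, Finset.mem_filter] at hD
      obtain ⟨σ, ⟨hσ, h3⟩, rfl⟩ := hD
      refine hA σ hσ π hπ.1 (by rintro rfl; omega) ?_
      rw [← Finset.insert_erase (hx σ hσ), Finset.insert_subset_iff]
      exact ⟨hx π hπ.1, ((Finset.mem_powersetCard.1 hDB).1.trans hB).trans (Finset.erase_subset _ _)⟩
    have hsub : B.powersetCard 2 ⊆ Y.powersetCard 2 :=
      Finset.powersetCard_mono (hB.trans (hsubY π hπ.1 (by omega)))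
    have := Finset.card_le_card (Finset.union_subset hQsub hsub)
    rw [Finset.card_union_of_disjoint hdisj, Finset.card_powersetCard, Finset.card_powersetCard,
      hB3, hQcard] at this
    simpa using this
  refine hsum.trans ?_
  have hchoose : 2 * Y.card.choose 2 = Y.card * (Y.card - 1) := by
    rw [Nat.choose_two_right, Nat.mul_div_cancel' (Nat.even_mul_pred_self _).two_dvd]
  suffices 2 * P₂.card ≤ 4 * m + P₄.card by
    have : (2 * P₂.card : ℚ) ≤ 4 * m + P₄.card := by exact_mod_cast this
    linarith
  by_contra! hlt
  have hY2 : Y.card + 2 ≤ m := by omega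
  have hchoose' : (2 * Y.card.choose 2 : ℤ) = Y.card * (Y.card - 1) := by
    rcases Nat.eq_zero_or_pos Y.card with h | h
    · simp [h]
    · have := congrArg (Nat.cast : ℕ → ℤ) hchoose
      push_cast [Nat.cast_sub h] at this
      exact this
  generalize Y.card.choose 2 = q at *
  generalize Y.card = d at *
  generalize P₂.card = g at *
  generalize P₃.card = b at *
  generalize P₄.card = B at *
  generalize P.card = p at *
  obtain ⟨e, rfl⟩ : ∃ e, m = d + 1 + e := ⟨m - 1 - d, by omega⟩
  have hg : g = 2 * d + 2 + 3 * e := by omega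
  have he : 1 ≤ e := by omega
  subst hg hcard
  zify at *
  -- Without larger sets the quadratic count already fails. With them the three lost triples matter:
  -- otherwise m = 9, d = 0, e = 8, B = 15 would survive.
  have hB : (B : ℤ) ≠ 0 := by
    intro h0
    rw [h0] at hP
    nlinarith
  have hb := hP₃le' (by exact_mod_cast hB)
  nlinarith

/-- Double counting of the weights over points and partitions; arguing by contradiction supplies the
size hypothesis of the local bound. -/
theorem card_le_of_isSpernerPartitionSystem {V : Type*} [Fintype V] [DecidableEq V]
    {m : ℕ} (hm : 9 ≤ m) (hV : Fintype.card V = 3 * m)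
    (P : Finset (Finpartition (Finset.univ : Finset V)))
    (hP : IsSpernerPartitionSystem (m + 2) P) : P.card ≤ m ^ 2 / 2 := by
  by_contra! hlt
  have hlt' : m ^ 2 + 1 ≤ 2 * P.card := by omega
  have hpt : ∀ x : V, ∑ π ∈ P, (3 / (π.part x).card - 1 : ℚ) ≤ m := by
    intro x
    refine sum_three_div_card_sub_one_le hm hV P hlt' (fun π => π.part x) x
      (fun π _ => π.mem_part (Finset.mem_univ x)) fun π hπ σ hσ hne => ?_
    exact hP.2 π hπ σ hσ hne _ (π.part_mem.2 (Finset.mem_univ x)) _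
      (σ.part_mem.2 (Finset.mem_univ x))
  have hk : ∀ π ∈ P, ∑ x : V, (3 / (π.part x).card - 1 : ℚ) = 6 := by
    intro π hπ
    -- Each class contributes 1 in total, so this sum counts the classes.
    have h1 : ∑ x : V, (1 / (π.part x).card : ℚ) = m + 2 := by
      have hbi : ∑ x : V, (1 / (π.part x).card : ℚ) =
          ∑ A ∈ π.parts, ∑ x ∈ id A, (1 / (π.part x).card : ℚ) := by
        rw [← Finset.sum_biUnion (t := id) π.supIndep.pairwiseDisjoint, ← Finset.sup_eq_biUnion,
          π.sup_parts]
      rw [hbi, ← Nat.cast_two, ← Nat.cast_add, ← hP.1 π hπ, Finset.card_eq_sum_ones, Nat.cast_sum]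
      refine Finset.sum_congr rfl fun A hA => ?_
      rw [Finset.sum_congr rfl fun x hx => by rw [π.part_eq_of_mem hA hx]]
      have : (A.card : ℚ) ≠ 0 := by exact_mod_cast (Finset.card_pos.2 (π.nonempty_of_mem_parts hA)).ne'
      rw [Finset.sum_const, nsmul_eq_mul]
      field_simp
      simp
    have h3 : ∀ x : V, (3 / (π.part x).card - 1 : ℚ) = 3 * (1 / (π.part x).card) - 1 :=
      fun x => by ring
    simp only [h3, Finset.sum_sub_distrib, ← Finset.mul_sum, h1]
    simp only [Finset.sum_const, Finset.card_univ, hV, nsmul_eq_mul]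
    push_cast
    ring
  have htot : (6 * P.card : ℚ) ≤ 3 * m * m := by
    have e₁ := Finset.sum_le_sum fun (x : V) (_ : x ∈ Finset.univ) => hpt x
    rw [Finset.sum_comm, Finset.sum_congr rfl hk] at e₁
    simp only [Finset.sum_const, Finset.card_univ, hV, nsmul_eq_mul] at e₁
    push_cast at e₁
    linarith
  have : 6 * P.card ≤ 3 * m * m := by exact_mod_cast htot
  nlinarith

/-! ### Partitions with prescribed profiles -/

/-- Disjoint subsets of prescribed sizes can be chosen in a set that is large enough. -/
theorem exists_colouring_card_eq {α C : Type*} [DecidableEq α] [Fintype C] [DecidableEq C]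
    (s : Finset α) (N : C → ℕ) (h : ∑ c, N c ≤ s.card) :
    ∃ f : α → Option C, ∀ c, (s.filter fun a => f a = some c).card = N c := by
  classical
  obtain ⟨φ⟩ : Nonempty ((Σ c, Fin (N c)) ↪ s) :=
    Function.Embedding.nonempty_of_card_le (by simpa using h)
  refine ⟨fun a => if ha : ∃ z, (φ z : α) = a then some ha.choose.1 else none, fun c => ?_⟩
  rw [← Fintype.card_fin (N c), ← Finset.card_univ]
  symm
  refine Finset.card_bij (fun i _ => (φ ⟨c, i⟩ : α)) ?_ ?_ ?_
  · intro i _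
    have ha : ∃ z, (φ z : α) = φ ⟨c, i⟩ := ⟨_, rfl⟩
    have : ha.choose = ⟨c, i⟩ := φ.injective (Subtype.ext ha.choose_spec)
    simp only [Finset.mem_filter, Finset.coe_mem, true_and, dif_pos ha, Option.some.injEq]
    rw [this]
  · intro i _ j _ hij
    simpa using φ.injective (Subtype.ext hij)
  · intro a ha
    simp only [Finset.mem_filter] at ha
    obtain ⟨-, ha⟩ := ha
    split_ifs at ha with hz
    obtain ⟨⟨c', i⟩, hi⟩ : ∃ z, z = hz.choose := ⟨_, rfl⟩
    have hc : c' = c := by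
      rw [← hi] at ha
      simpa using ha
    subst hc
    exact ⟨i, Finset.mem_univ _, by rw [hi]; exact hz.choose_spec⟩

theorem fibreProfile_mono {V ι : Type*} [DecidableEq ι] (g : V → ι) {E E' : Finset V} (h : E ⊆ E') :
    fibreProfile g E ≤ fibreProfile g E' :=
  fun _ => Finset.card_le_card (Finset.filter_subset_filter _ h)

theorem sum_fibreProfile {V ι : Type*} [Fintype ι] [DecidableEq ι] (g : V → ι) (E : Finset V) : ∑ i, fibreProfile g E i = E.card :=
  (Finset.card_eq_sum_card_fiberwise fun _ _ => Finset.mem_coe.2 (Finset.mem_univ _)).symm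

section Construction

variable {V ι C J : Type*} [Fintype V] [DecidableEq V] [Fintype ι] [DecidableEq ι] [Fintype C]
  [DecidableEq C] [Fintype J]

/-- A Baranyai-type theorem: if there are enough sets of each profile, and the sets prescribed for
each colour cover every fibre exactly once on average, then the colour classes can be chosen to be
pairwise disjoint partitions of the vertex set. -/
theorem exists_disjoint_partitions (g : V → ι) (T : J → ι → ℕ) (hT : Function.Injective T)
    (N : C → J → ℕ) (hN : ∀ j, ∑ c, N c j ≤ (Finset.univ.filter fun E => fibreProfile g E = T j).card)
    (hcover : ∀ c i, ∑ j, N c j * T j i = (Finset.univ.filter fun v => g v = i).card) :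
    ∃ γ : Finset V → Option C,
      (∀ c, (Finset.univ.filter fun E => (∃ j, fibreProfile g E = T j) ∧ γ E = some c).card =
        ∑ j, N c j) ∧
      ∀ c v, ∃! E, ((∃ j, fibreProfile g E = T j) ∧ γ E = some c) ∧ v ∈ E := by
  classical
  choose f hf using fun j => exists_colouring_card_eq
    (Finset.univ.filter fun E => fibreProfile g E = T j) (fun c => N c j) (hN j)
  set ℰ : Finset (Finset V) := Finset.univ.filter fun E => ∃ j, fibreProfile g E = T j with hℰ
  -- Unused sets get the colour `none`, so that `ℰ` contains all sets of each profile and is closed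
  -- as required.
  obtain ⟨γ, h₁, h₂⟩ := exists_equitable_recolouring g ℰ
    (fun E E' h hE => by simpa [hℰ, ← h] using hE)
    (fun E => if h : ∃ j, fibreProfile g E = T j then f h.choose E else none)
  have hcount : ∀ c j, (ℰ.filter fun E => γ E = some c ∧ fibreProfile g E = T j).card = N c j := by
    intro c j
    rw [h₁, ← hf j c, hℰ, Finset.filter_filter, Finset.filter_filter]
    congr 1
    ext E
    simp only [Finset.mem_filter, Finset.mem_univ, true_and]
    constructor
    · rintro ⟨h, hc, hj⟩
      have : h.choose = j := hT (h.choose_spec.symm.trans hj)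
      rw [dif_pos h, this] at hc
      exact ⟨hj, hc⟩
    · rintro ⟨hj, hc⟩
      have h : ∃ j, fibreProfile g E = T j := ⟨j, hj⟩
      have : h.choose = j := hT (h.choose_spec.symm.trans hj)
      refine ⟨h, ?_, hj⟩
      rw [dif_pos h, this, hc]
  have hsplit : ∀ c (w : Finset V → ℕ), ∑ E ∈ ℰ with γ E = some c, w E =
      ∑ j, ∑ E ∈ ℰ with γ E = some c ∧ fibreProfile g E = T j, w E := by
    intro c w
    simp only [Finset.sum_filter]
    rw [Finset.sum_comm]
    refine Finset.sum_congr rfl fun E hE => ?_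
    obtain ⟨j, hj⟩ := (Finset.mem_filter.1 hE).2
    rw [Finset.sum_eq_single_of_mem j (Finset.mem_univ j)]
    · simp [hj]
    · intro j' _ hne
      rw [if_neg]
      rintro ⟨-, h⟩
      exact hne (hT (h.symm.trans hj))
  have hdeg : ∀ c v, colourDegree ℰ γ c v = (ℰ.filter fun E => γ E = c ∧ v ∈ E).card := by
    intro c v
    rw [colourDegree, Finset.sum_boole, Finset.filter_filter]
  have htotal : ∀ c i, ∑ v with g v = i, colourDegree ℰ γ (some c) v =
      (Finset.univ.filter fun v => g v = i).card := by
    intro c i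
    rw [← hcover c i]
    have : ∑ E ∈ ℰ with γ E = some c, fibreProfile g E i = ∑ j, N c j * T j i := by
      rw [hsplit]
      refine Finset.sum_congr rfl fun j _ => ?_
      rw [← hcount c j, ← smul_eq_mul, ← Finset.sum_const]
      refine Finset.sum_congr rfl fun E hE => ?_
      rw [(Finset.mem_filter.1 hE).2.2]
    rw [← this]
    simp only [colourDegree]
    rw [Finset.sum_comm]
    push_cast
    refine Finset.sum_congr rfl fun E _ => ?_
    rw [Finset.sum_boole, fibreProfile, Finset.filter_filter]
    congr 2
    ext v
    simp [and_comm]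
  -- On each fibre the degrees average 1 and differ by at most 1, so all equal 1.
  have hone : ∀ c v, colourDegree ℰ γ (some c) v = 1 := by
    intro c v
    have ht := htotal c (g v)
    have hv : v ∈ Finset.univ.filter fun u => g u = g v := by simp
    rw [Finset.card_eq_sum_ones, Nat.cast_sum] at ht
    push_cast at ht
    have hmem : ∀ u, u ∈ Finset.univ.filter (fun u => g u = g v) ↔ g u = g v := by simp
    rcases lt_trichotomy (colourDegree ℰ γ (some c) v) 1 with h | h | h
    · refine absurd ht (ne_of_lt (Finset.sum_lt_sum (fun u hu => ?_) ⟨v, hv, h⟩))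
      have := h₂ (some c) u v ((hmem u).1 hu)
      omega
    · exact h
    · refine absurd ht (ne_of_gt (Finset.sum_lt_sum (fun u hu => ?_) ⟨v, hv, h⟩))
      have := h₂ (some c) v u ((hmem u).1 hu).symm
      omega
  refine ⟨γ, fun c => ?_, fun c v => ?_⟩
  · have := hsplit c fun _ => 1
    simp only [← Finset.card_eq_sum_ones, hcount] at this
    rw [← this, hℰ, Finset.filter_filter]
  · have h := hone c v
    rw [hdeg] at h
    obtain ⟨E, hE⟩ := Finset.card_eq_one.1 (by exact_mod_cast h)
    refine ⟨E, ?_, fun E' hE' => ?_⟩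
    · have := Finset.mem_singleton_self E
      rw [← hE] at this
      simpa [hℰ, and_assoc] using this
    · rw [← Finset.mem_singleton, ← hE]
      simpa [hℰ, and_assoc] using hE'

/-- Profiles that form an antichain give Sperner partition systems. -/
theorem exists_isSpernerPartitionSystem [Nonempty V] (g : V → ι) (T : J → ι → ℕ)
    (hanti : ∀ j j', T j ≤ T j' → j = j') (hT₀ : ∀ j, T j ≠ 0)
    (N : C → J → ℕ) (hN : ∀ j, ∑ c, N c j ≤ (Finset.univ.filter fun E => fibreProfile g E = T j).card)
    (hcover : ∀ c i, ∑ j, N c j * T j i = (Finset.univ.filter fun v => g v = i).card)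
    (k : ℕ) (hk : ∀ c, ∑ j, N c j = k) :
    ∃ P : Finset (Finpartition (Finset.univ : Finset V)),
      IsSpernerPartitionSystem k P ∧ P.card = Fintype.card C := by
  classical
  obtain ⟨γ, hcard, huniq⟩ := exists_disjoint_partitions g T
    (fun j j' h => hanti j j' h.le) N hN hcover
  let π : C → Finpartition (Finset.univ : Finset V) := fun c =>
    Finpartition.ofExistsUnique
      (Finset.univ.filter fun E => (∃ j, fibreProfile g E = T j) ∧ γ E = some c)
      (fun E _ => Finset.subset_univ E)
      (fun v _ => by simpa using huniq c v)
      (by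
        simp only [Finset.mem_filter, Finset.mem_univ, true_and, not_and]
        rintro ⟨j, hj⟩
        exact absurd (hj.symm.trans (by ext; simp [fibreProfile])) (hT₀ j))
  have hparts : ∀ c E, E ∈ (π c).parts ↔ (∃ j, fibreProfile g E = T j) ∧ γ E = some c := by
    intro c E
    simp [π, Finpartition.ofExistsUnique]
  -- Inclusion forces comparable, hence equal, profiles; then the sizes agree, so the sets and their
  -- colours coincide.
  have hsub : ∀ c c' E E', E ∈ (π c).parts → E' ∈ (π c').parts → E ⊆ E' → c = c' := by
    intro c c' E E' hE hE' h
    rw [hparts] at hE hE'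
    obtain ⟨⟨j, hj⟩, hc⟩ := hE
    obtain ⟨⟨j', hj'⟩, hc'⟩ := hE'
    have hjj : j = j' := hanti j j' (by rw [← hj, ← hj']; exact fibreProfile_mono g h)
    have : E = E' := Finset.eq_of_subset_of_card_le h (by
      rw [← sum_fibreProfile g E, ← sum_fibreProfile g E', hj, hj', hjj])
    rw [this, hc'] at hc
    exact (Option.some.inj hc).symm
  have hinj : Function.Injective π := by
    intro c c' h
    obtain ⟨v⟩ := ‹Nonempty V›
    have hv := (π c).part_mem.2 (Finset.mem_univ v)
    exact hsub c c' _ _ hv (h ▸ hv) subset_rfl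
  refine ⟨Finset.univ.image π, ⟨?_, ?_⟩, ?_⟩
  · simp only [Finset.mem_image, Finset.mem_univ, true_and]
    rintro _ ⟨c, rfl⟩
    rw [← hk c, ← hcard c]
    rfl
  · simp only [Finset.mem_image, Finset.mem_univ, true_and]
    rintro _ ⟨c, rfl⟩ _ ⟨c', rfl⟩ hne A hA B hB h
    exact hne (congrArg π (hsub c c' A B hA hB h))
  · rw [Finset.card_image_of_injective _ hinj, Finset.card_univ]

end Construction

/-! ### Systems of pairs and triples -/

/-- The profiles of the triples within a fibre and of the pairs that avoid a fibre and meet the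
other two. -/
def pairTripleProfile : Fin 3 ⊕ Fin 3 → Fin 3 → ℕ
  | Sum.inl i => fun j => if j = i then 3 else 0
  | Sum.inr i => fun j => if j = i then 0 else 1

/-- A Sperner partition system of pairs and triples, from the numbers `t c i` of triples in the
fibre `i` and the numbers `q c i` of pairs avoiding the fibre `i` in the partition `c`. -/
theorem exists_isSpernerPartitionSystem_pairs_triples {V C : Type*} [Fintype V] [DecidableEq V]
    [Fintype C] [DecidableEq C] {m : ℕ} (hm : 0 < m) (g : V → Fin 3)
    (hg : ∀ i, (Finset.univ.filter fun v => g v = i).card = m) (t q : C → Fin 3 → ℕ)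
    (ht : ∀ i, ∑ c, t c i ≤ m.choose 3) (hq : ∀ i, ∑ c, q c i ≤ m ^ 2)
    (hcover : ∀ c i, 3 * t c i + ∑ j, q c j = m + q c i) (hsix : ∀ c, ∑ i, q c i = 6) :
    ∃ P : Finset (Finpartition (Finset.univ : Finset V)),
      IsSpernerPartitionSystem (m + 2) P ∧ P.card = Fintype.card C := by
  have : Nonempty V := by
    obtain ⟨v, -⟩ := Finset.card_pos.1 ((hg 0).symm ▸ hm)
    exact ⟨v⟩
  refine exists_isSpernerPartitionSystem g pairTripleProfile (by
    rintro (i | i) (j | j) h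
    all_goals
      have h0 := h 0
      have h1 := h 1
      have h2 := h 2
      fin_cases i <;> fin_cases j <;> simp [pairTripleProfile] at h0 h1 h2 ⊢)
    (by
      rintro (i | i) h
      · have := congrFun h i
        simp [pairTripleProfile] at this
      · have := congrFun h (i + 1)
        simp [pairTripleProfile] at this)
    (fun c => Sum.elim (t c) (q c)) ?_ ?_ _ ?_
  · rintro (i | i)
    · refine (ht i).trans ?_
      rw [← hg i, ← Finset.card_powersetCard]
      refine Finset.card_le_card fun E hE => ?_
      rw [Finset.mem_powersetCard] at hE
      simp only [Finset.mem_filter, Finset.mem_univ, true_and]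
      have hEi : ∀ v ∈ E, g v = i := fun v hv => (Finset.mem_filter.1 (hE.1 hv)).2
      ext j
      rcases eq_or_ne j i with rfl | hj
      · simp only [fibreProfile, pairTripleProfile, if_true]
        rw [Finset.filter_true_of_mem hEi, hE.2]
      · simp only [fibreProfile, pairTripleProfile, hj, if_false]
        rw [Finset.filter_false_of_mem fun v hv => by rw [hEi v hv]; exact hj.symm]
        rfl
    · refine (hq i).trans ?_
      have hne : i + 1 ≠ i + 2 := by fin_cases i <;> decide
      have hcases : ∀ j, j = i ∨ j = i + 1 ∨ j = i + 2 := by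
        intro j
        fin_cases i <;> fin_cases j <;> decide
      have h1i : i + 1 ≠ i := by fin_cases i <;> decide
      have h2i : i + 2 ≠ i := by fin_cases i <;> decide
      rw [sq]
      nth_rewrite 1 [← hg (i + 1)]
      rw [← hg (i + 2), ← Finset.card_product]
      refine Finset.card_le_card_of_injOn (fun z => {z.1, z.2}) ?_ ?_
      · rintro ⟨a, b⟩ hz
        simp only [Finset.coe_product, Set.mem_prod, Finset.mem_coe, Finset.mem_filter,
          Finset.mem_univ, true_and] at hz ⊢
        obtain ⟨ha, hb⟩ := hz
        ext j
        simp only [fibreProfile, pairTripleProfile, Finset.filter_insert, Finset.filter_singleton,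
          ha, hb]
        rcases hcases j with rfl | rfl | rfl
        · simp [h1i, h2i]
        · simp [h1i, hne.symm]
        · simp [h2i, hne]
      · rintro ⟨a, b⟩ hz ⟨a', b'⟩ hz' h
        simp only [Finset.coe_product, Set.mem_prod, Finset.mem_coe, Finset.mem_filter,
          Finset.mem_univ, true_and] at hz hz'
        dsimp only at h
        have h1 : a ∈ ({a', b'} : Finset V) := h ▸ Finset.mem_insert_self a _
        have h2 : b ∈ ({a', b'} : Finset V) := h ▸ by simp
        simp only [Finset.mem_insert, Finset.mem_singleton] at h1 h2
        have ha : a = a' := by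
          refine h1.resolve_right ?_
          rintro rfl
          exact hne (hz.1.symm.trans hz'.2)
        have hb : b = b' := by
          refine h2.resolve_left ?_
          rintro rfl
          exact hne (hz'.1.symm.trans hz.2)
        rw [ha, hb]
  · intro c i
    rw [hg]
    have h := hcover c i
    rw [Fin.sum_univ_three] at h
    rw [Fintype.sum_sum_type]
    simp only [Sum.elim_inl, Sum.elim_inr, pairTripleProfile, Fin.sum_univ_three]
    fin_cases i <;> simp at h ⊢ <;> omega
  · intro c
    have h0 := hcover c 0
    have h1 := hcover c 1
    have h2 := hcover c 2
    have h6 := hsix c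
    rw [Fintype.sum_sum_type]
    simp only [Sum.elim_inl, Sum.elim_inr, Fin.sum_univ_three] at *
    omega

theorem six_mul_choose_three_add (m : ℕ) : 6 * m.choose 3 + 3 * m ^ 2 = m ^ 3 + 2 * m := by
  have h := Nat.descFactorial_eq_factorial_mul_choose m 3
  rcases m with _ | _ | m
  · rfl
  · rfl
  · have h3 : (m + 1 + 1).descFactorial 3 = (m + 2) * (m + 1) * m := by
      simp only [Nat.descFactorial_succ, Nat.descFactorial_zero, Nat.add_sub_cancel, Nat.sub_zero]
      rw [show m + 1 + 1 - 2 = m by omega]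
      ring
    rw [h3, show Nat.factorial 3 = 6 from rfl] at h
    rw [← h]
    ring

/-- Covering fibre i requires 3t_i = m - 6 + q_i, so q_i ≡ -m mod 3, with the q_i summing to 6. For
m ≡ 2 mod 6 each q would be a permutation of (4,1,1), and 2p = m² would force each fibre to be the
special one in exactly p/3 partitions, although 3 does not divide p; hence the exclusion. -/
theorem exists_isSpernerPartitionSystem_card {V : Type*} [Fintype V] [DecidableEq V] {m : ℕ}
    (hm : 9 ≤ m) (hmod : m % 6 ≠ 2) (g : V → Fin 3)
    (hg : ∀ i, (Finset.univ.filter fun v => g v = i).card = m) :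
    ∃ P : Finset (Finpartition (Finset.univ : Finset V)),
      IsSpernerPartitionSystem (m + 2) P ∧ P.card = m ^ 2 / 2 := by
  have hch := six_mul_choose_three_add m
  have hm0 : 0 < m := by omega
  have rotate : ∀ (r a b : ℕ) (i : Fin 3),
      ∑ c : Fin r × Fin 3, (if i = c.2 then a else b) = r * (a + 2 * b) := by
    intro r a b i
    rw [Fintype.sum_prod_type]
    have h : ∑ s : Fin 3, (if i = s then a else b) = a + 2 * b := by
      rw [Fin.sum_univ_three]
      fin_cases i <;> simp <;> ring
    simp only [h, Finset.sum_const, Finset.card_univ, Fintype.card_fin, smul_eq_mul]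
  -- The pair counts are (2,2,2) for m ≡ 1 mod 3, rotations of (0,3,3) for m ≡ 0, and rotations of
  -- (4,1,1) for m ≡ 5 mod 6.
  rcases (by omega : m % 3 = 1 ∨ m % 6 = 0 ∨ m % 6 = 3 ∨ m % 6 = 5) with h | h | h | h
  · obtain ⟨a, ha⟩ : ∃ a, m = 3 * a + 4 := ⟨(m - 4) / 3, by omega⟩
    obtain ⟨P, hP, hc⟩ := exists_isSpernerPartitionSystem_pairs_triples (C := Fin (m ^ 2 / 2)) hm0 g
      hg (fun _ _ => a) (fun _ _ => 2) (by
        intro i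
        simp only [Finset.sum_const, Finset.card_univ, Fintype.card_fin, smul_eq_mul]
        have : 2 * (m ^ 2 / 2) ≤ m ^ 2 := Nat.mul_div_le _ _
        generalize m ^ 2 / 2 = p at this
        generalize m.choose 3 = C at hch ⊢
        subst ha
        nlinarith)
      (by
        intro i
        simp only [Finset.sum_const, Finset.card_univ, Fintype.card_fin, smul_eq_mul]
        omega)
      (by intro c i; simp only [Fin.sum_univ_three]; omega) (fun c => by simp)
    exact ⟨P, hP, by simpa using hc⟩
  · obtain ⟨a, rfl⟩ : ∃ a, m = 6 * a := ⟨m / 6, by omega⟩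
    have hp : (6 * a) ^ 2 / 2 = (6 * a ^ 2) * 3 := by
      rw [show (6 * a) ^ 2 = 2 * (6 * a ^ 2 * 3) by ring]
      omega
    obtain ⟨b, rfl⟩ : ∃ b, a = b + 1 := ⟨a - 1, by omega⟩
    obtain ⟨P, hP, hc⟩ := exists_isSpernerPartitionSystem_pairs_triples
      (C := Fin (6 * (b + 1) ^ 2) × Fin 3) hm0 g hg
      (fun c i => if i = c.2 then 2 * b else 2 * b + 1) (fun c i => if i = c.2 then 0 else 3) (by
        intro i
        rw [rotate]
        nlinarith)
      (by intro i; rw [rotate]; nlinarith)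
      (by
        rintro ⟨c, s⟩ i
        simp only [Fin.sum_univ_three]
        fin_cases s <;> fin_cases i <;> simp <;> omega)
      (by
        rintro ⟨c, s⟩
        simp only [Fin.sum_univ_three]
        fin_cases s <;> simp)
    exact ⟨P, hP, by rw [hc, hp]; simp⟩
  · obtain ⟨a, rfl⟩ : ∃ a, m = 6 * a + 3 := ⟨m / 6, by omega⟩
    have hp : (6 * a + 3) ^ 2 / 2 = (6 * a ^ 2 + 6 * a + 1) * 3 + 1 := by
      rw [show (6 * a + 3) ^ 2 = 2 * ((6 * a ^ 2 + 6 * a + 1) * 3 + 1) + 1 by ring]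
      omega
    obtain ⟨b, rfl⟩ : ∃ b, a = b + 1 := ⟨a - 1, by omega⟩
    -- Here p ≡ 1 mod 3: `none` indexes one partition beyond the full rotations, with special fibre
    -- 0. Its at most 3 pairs of each kind exactly fit, since m² = 6r + 3 after r rotations.
    obtain ⟨P, hP, hc⟩ := exists_isSpernerPartitionSystem_pairs_triples
      (C := Option (Fin (6 * (b + 1) ^ 2 + 6 * (b + 1) + 1) × Fin 3)) hm0 g hg
      (fun c i => if i = (c.map Prod.snd).getD 0 then 2 * b + 1 else 2 * b + 2)
      (fun c i => if i = (c.map Prod.snd).getD 0 then 0 else 3) (by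
        intro i
        rw [Fintype.sum_option]
        simp only [Option.map_some, Option.map_none, Option.getD_some, Option.getD_none]
        rw [rotate]
        have : (if i = 0 then 2 * b + 1 else 2 * b + 2) ≤ 2 * b + 2 := by split_ifs <;> omega
        nlinarith)
      (by
        intro i
        rw [Fintype.sum_option]
        simp only [Option.map_some, Option.map_none, Option.getD_some, Option.getD_none]
        rw [rotate]
        have : (if i = 0 then 0 else 3) ≤ 3 := by split_ifs <;> omega
        nlinarith)
      (by
        intro c i
        generalize (c.map Prod.snd).getD 0 = s
        simp only [Fin.sum_univ_three]
        fin_cases s <;> fin_cases i <;> simp <;> omega)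
      (by
        intro c
        generalize (c.map Prod.snd).getD 0 = s
        simp only [Fin.sum_univ_three]
        fin_cases s <;> simp)
    exact ⟨P, hP, by rw [hc, hp]; simp⟩
  · obtain ⟨a, rfl⟩ : ∃ a, m = 6 * a + 5 := ⟨m / 6, by omega⟩
    have hp : (6 * a + 5) ^ 2 / 2 = (6 * a ^ 2 + 10 * a + 4) * 3 := by
      rw [show (6 * a + 5) ^ 2 = 2 * ((6 * a ^ 2 + 10 * a + 4) * 3) + 1 by ring]
      omega
    obtain ⟨P, hP, hc⟩ := exists_isSpernerPartitionSystem_pairs_triples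
      (C := Fin (6 * a ^ 2 + 10 * a + 4) × Fin 3) hm0 g hg
      (fun c i => if i = c.2 then 2 * a + 1 else 2 * a) (fun c i => if i = c.2 then 4 else 1) (by
        intro i
        rw [rotate]
        nlinarith)
      (by intro i; rw [rotate]; nlinarith)
      (by
        rintro ⟨c, s⟩ i
        simp only [Fin.sum_univ_three]
        fin_cases s <;> fin_cases i <;> simp <;> omega)
      (by
        rintro ⟨c, s⟩
        simp only [Fin.sum_univ_three]
        fin_cases s <;> simp)
    exact ⟨P, hP, by rw [hc, hp]; simp⟩

theorem mainTheorem4 (n k : ℕ) (hk : 11 ≤ k) (hmod : ¬ k ≡ 4 [MOD 6])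
    (hn : (n : ℤ) = 3 * (k : ℤ) - 6) :
    (SP n k : ℤ) = ⌊(1 / 2 : ℚ) * ((k : ℚ) - 2) ^ 2⌋ := by
  obtain ⟨m, rfl⟩ : ∃ m, k = m + 2 := ⟨k - 2, by omega⟩
  obtain rfl : n = 3 * m := by omega
  have hfib : ∀ i : Fin 3, (Finset.univ.filter fun v : Fin (3 * m) =>
      (finProdFinEquiv.symm v).1 = i).card = m := by
    intro i
    refine (Finset.card_bij (s := (Finset.univ : Finset (Fin m)))
      (fun j _ => finProdFinEquiv (i, j)) ?_ ?_ ?_).symm.trans (Finset.card_fin m)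
    · intro j _
      rw [Finset.mem_filter, Equiv.symm_apply_apply]
      exact ⟨Finset.mem_univ _, rfl⟩
    · intro j _ j' _ h
      simpa using h
    · intro v hv
      refine ⟨(finProdFinEquiv.symm v).2, Finset.mem_univ _, ?_⟩
      rw [← (Finset.mem_filter.1 hv).2, Prod.mk.eta, Equiv.apply_symm_apply]
  have hSP : SP (3 * m) (m + 2) = m ^ 2 / 2 := by
    refine (SP_isGreatest _ _).unique ⟨?_, ?_⟩
    · exact exists_isSpernerPartitionSystem_card (by omega)
        (fun h => hmod (by unfold Nat.ModEq; omega)) _ hfib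
    · rintro p ⟨P, hP, rfl⟩
      exact card_le_of_isSpernerPartitionSystem (by omega) (Fintype.card_fin _) P hP
  rw [hSP]
  have h := Rat.floor_intCast_div_natCast ((m : ℤ) ^ 2) 2
  push_cast at h ⊢
  rw [← h]
  congr 1
  ring
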